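/- **Setting.** A signature $L$ is a countable set of predicate symbols. Each symbol $R$ carries an arity, a modulus of continuity $\Delta_R$ (a continuous $\Delta:[0,\infty)\to[0,\infty)$ with $\Delta(0)=0$ and $\Delta(r)\le\Delta(r+s)\le\Delta(r)+\Delta(s)$) and a compact interval $I_R\subseteq\mathbb R$; one binary symbol $d$ is reserved for the metric. In a Polish metric structure $M$ (complete, separable) $d$ is interpreted as the metric and every $R$ as a function to $I_R$ respecting $\Delta_R$ for the maximum metric. Formulas of infinitary continuous logic are built from the atomic formulas and the constant $1$ by $\phi+\psi$, $r\phi$ ($r\in\mathbb Q$), $\max(\phi,\psi)$, $\sup_x$, $\inf_x$, and $\bigvee_n\phi_n$, $\bigwedge_n\phi_n$ (countable supremum and infimum) for formulas $\phi_n$ with the same finite set of free variables respecting a common modulus of continuity and bound. A fragment $F$ is a countable set of formulas containing all atomic formulas and closed under finitary connectives (including the constant $1$), quantifiers, subformulas and substitution. For finite or infinite tuples let $d(\bar a,\bar b)=\max\{d(a_i,b_i): i<\min(|\bar a|,|\bar b|)\}$; balls $B_u$ are open balls for $d$, and a ball around the empty tuple is the whole space. $\mathrm{Mod}(L)$ is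 the set of all $\xi\in\prod_{R\in L}\mathbb R^{\mathbb N^{n_R}}$ ($n_R$ the arity of $R$) of the form $\xi(R)(j_0,j_1,\dots)=R^{M}(a_{j_0},a_{j_1},\dots)$ for a Polish metric structure $M=M_\xi$ and a sequence $(a_i)_{i\in\mathbb N}$ in $M$ that is tail-dense (each of its tails is dense). One identifies $\xi$ with $M_\xi$ together with this sequence, and a tuple $\bar a\in\mathbb N^{<\mathbb N}$ names the corresponding tuple of elements of the sequence. $[M]\subseteq\mathrm{Mod}(L)$ is the isomorphism class of $M$. The topology $t_F$ on $\mathrm{Mod}(L)$ is generated by the sets $\{M:\phi^M(\bar a)<r\}$, $\phi\in F$, $\bar a\in\mathbb N^{<\mathbb N}$, $r\in\mathbb Q$, and $\boldsymbol\Pi^0_\alpha(t_F)$ is the $\alpha$-th multiplicative Borel class of $t_F$ (so $\boldsymbol\Pi^0_1$ = closed sets). Let $D(M)$ be the space of tail-dense sequences in $M$ (a subspace of $M^{\mathbb N}$), and for $y\in D(M)$ let $\pi(y)\in \mathrm{Mod}(L)$ be the code of $M$ with the distinguished sequence $y$. For $A\subseteq\mathrm{Mod}(L)$, $\bar a\in\mathbb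 N^{<\mathbb N}$ and rational $u>0$ put $$A^{*\bar a,u}=\{M\in \mathrm{Mod}(L):\ \pi(y)\in A\text{ for comeagerly many }y\in B^{D(M)}_u(\bar a)\}.$$ **AE families.** For an ordinal $\alpha<\omega_1$ or $\alpha=-1$, and a finite tuple of variables $\bar x$, the $\alpha$-AE families $P(\bar x)$ over $F$, and what it means for a tuple $\bar a$ of $M$ with $|\bar a|=|\bar x|$ to realize $P(\bar x)$ in $M$, are defined by recursion. * A $(-1)$-AE family is a formula $\phi(\bar x)\in F$; $\bar a$ realizes it iff $\phi^M(\bar a)=0$. * If $\beta=0$ or $\beta$ is a limit ordinal, a $\beta$-AE family is a collection $\{p_k(\bar x):k\in\mathbb N\}$, each $p_k$ being a $\gamma$-AE family for some $\gamma<\beta$; $\bar a$ realizes it iff it realizes every $p_k$. * If $\beta=0$ or $\beta$ is a limit ordinal and $1\le n<\omega$, a $(\beta+n)$-AE family is a collection $\{p_{k,l}(\bar x_{k,l}):k,l\in\mathbb N\}$ with $\bar x\subseteq\bar x_{k,l}$, where each $p_{k,l}$ is a $\gamma$-AE family for some $\gamma<\beta$ if $n=1$, and a $(\beta+n-2)$-AE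 family if $n\ge2$; $\bar a$ realizes it iff $$\forall \bar b\in B^{M^{<\omega}}_{u_P}(\bar a)\ \forall v>0\ \forall k\ \exists \bar c\in B^{M^{<\omega}}_v(\bar b)\ \exists l\ (\bar c\text{ realizes }p_{k,l}(\bar x_{k,l})\text{ in }M).$$ Here every $\alpha$-AE family $P$ with $\alpha\ge1$ comes with a fixed real $u_P\ge0$ such that $u_P\ge u_p$ for all members $p$ of $P$ that have a $u_p$. $M$ models $P(\emptyset)$ iff the empty tuple realizes it in $M$. **Theorem.** Let $F$ be a fragment in signature $L$ and let $1\le\alpha<\omega_1$. 1. If $A\subseteq \mathrm{Mod}(L)$ is in $\boldsymbol\Pi^0_{1+\alpha}(t_F)$, then for every $\bar a\in\mathbb N^{<\mathbb N}$ and every rational $u>0$ there is an $\alpha$-AE family $P(\bar x)$ over $F$ with $$A^{*\bar a,u}=\{N\in\mathrm{Mod}(L):\ \bar a\text{ realizes }P(\bar x)\text{ in }N\}.$$ 2. If $M\in\mathrm{Mod}(L)$ and $[M]\in\boldsymbol\Pi^0_{1+\alpha}(t_F)$, then there is an $\alpha$-AE family $P_M=P_M(\emptyset)$ over $F$ with $$[M]=\{N\in\mathrm{Mod}(L):\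 N\text{ models }P_M\}.$$ -/

import Mathlib

open scoped NNReal Ordinal

namespace MetricLogic

/-- Moduli of continuity. -/
structure IsModulus (Δ : ℝ≥0 → ℝ≥0) : Prop where
  continuous : Continuous Δ
  map_zero : Δ 0 = 0
  mono : ∀ r s, Δ r ≤ Δ (r + s)
  subadd : ∀ r s, Δ (r + s) ≤ Δ r + Δ s

/-- A countable relational signature. Every predicate symbol `R` carries an arity, a modulus of
continuity and a compact interval `[lo R, hi R]`; one of the symbols is the binary symbol `d`
for the metric. -/
structure Signature where
  Rel : Type
  countable_rel : Countable Rel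
  arity : Rel → ℕ
  modulus : Rel → ℝ≥0 → ℝ≥0
  isModulus : ∀ R, IsModulus (modulus R)
  lo : Rel → ℝ
  hi : Rel → ℝ
  lo_le_hi : ∀ R, lo R ≤ hi R
  d : Rel
  arity_d : arity d = 2

/-- Polish metric structures. The metric on `Fin k → carrier` used in `respects` is the maximum
metric. -/
structure PolishStructure (L : Signature) where
  carrier : Type
  [metric : MetricSpace carrier]
  [complete : CompleteSpace carrier]
  [separable : TopologicalSpace.SeparableSpace carrier]
  rel : ∀ R : L.Rel, (Fin (L.arity R) → carrier) → ℝ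
  rel_d : ∀ x y : carrier, rel L.d (fun t => if (t : ℕ) = 0 then x else y) = dist x y
  respects : ∀ R x y, nndist (rel R x) (rel R y) ≤ L.modulus R (nndist x y)
  bound : ∀ R x, rel R x ∈ Set.Icc (L.lo R) (L.hi R)

attribute [instance] PolishStructure.metric PolishStructure.complete PolishStructure.separable

/-- Isomorphism of structures: a bijection preserving the metric and all predicates. -/
def Isomorphic {L : Signature} (M N : PolishStructure L) : Prop :=
  ∃ e : M.carrier ≃ᵢ N.carrier, ∀ R x, N.rel R (e ∘ x) = M.rel R x

/-- Expressions of infinitary continuous logic in `n` free variables. A quantifier binds the last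
variable of its body. (In a relational language the only terms are the variables.) -/
inductive PreFormula (L : Signature) : ℕ → Type
  | one {n : ℕ} : PreFormula L n
  | atom {n : ℕ} (R : L.Rel) (x : Fin (L.arity R) → Fin n) : PreFormula L n
  | add {n : ℕ} (φ ψ : PreFormula L n) : PreFormula L n
  | smul {n : ℕ} (r : ℚ) (φ : PreFormula L n) : PreFormula L n
  | max {n : ℕ} (φ ψ : PreFormula L n) : PreFormula L n
  | sup {n : ℕ} (φ : PreFormula L (n + 1)) : PreFormula L n
  | inf {n : ℕ} (φ : PreFormula L (n + 1)) : PreFormula L n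
  | iSup {n : ℕ} (φ : ℕ → PreFormula L n) : PreFormula L n
  | iInf {n : ℕ} (φ : ℕ → PreFormula L n) : PreFormula L n

namespace PreFormula

variable {L : Signature}

/-- `φ.Respects Δ lo hi`: the modulus of continuity and the bound of `φ`, as calculated from its
constituents, are at most `Δ` and contained in `[lo, hi]`. In an infinitary connective all
constituents have to respect a common modulus and a common bound. -/
inductive Respects : ∀ {n : ℕ}, PreFormula L n → (ℝ≥0 → ℝ≥0) → ℝ → ℝ → Prop
  | one {n : ℕ} : Respects (PreFormula.one : PreFormula L n) (fun _ => 0) 1 1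
  | atom {n : ℕ} (R : L.Rel) (x : Fin (L.arity R) → Fin n) :
      Respects (PreFormula.atom R x) (L.modulus R) (L.lo R) (L.hi R)
  | add {n : ℕ} {φ ψ : PreFormula L n} {Δ Δ' : ℝ≥0 → ℝ≥0} {lo hi lo' hi' : ℝ} :
      Respects φ Δ lo hi → Respects ψ Δ' lo' hi' →
      Respects (PreFormula.add φ ψ) (fun t => Δ t + Δ' t) (lo + lo') (hi + hi')
  | smul {n : ℕ} {φ : PreFormula L n} {Δ : ℝ≥0 → ℝ≥0} {lo hi : ℝ} (r : ℚ) :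
      Respects φ Δ lo hi →
      Respects (PreFormula.smul r φ) (fun t => ‖(r : ℝ)‖₊ * Δ t)
        (Min.min ((r : ℝ) * lo) ((r : ℝ) * hi)) (Max.max ((r : ℝ) * lo) ((r : ℝ) * hi))
  | max {n : ℕ} {φ ψ : PreFormula L n} {Δ Δ' : ℝ≥0 → ℝ≥0} {lo hi lo' hi' : ℝ} :
      Respects φ Δ lo hi → Respects ψ Δ' lo' hi' →
      Respects (PreFormula.max φ ψ) (fun t => Max.max (Δ t) (Δ' t))
        (Max.max lo lo') (Max.max hi hi')
  | sup {n : ℕ} {φ : PreFormula L (n + 1)} {Δ : ℝ≥0 → ℝ≥0} {lo hi : ℝ} :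
      Respects φ Δ lo hi → Respects (PreFormula.sup φ) Δ lo hi
  | inf {n : ℕ} {φ : PreFormula L (n + 1)} {Δ : ℝ≥0 → ℝ≥0} {lo hi : ℝ} :
      Respects φ Δ lo hi → Respects (PreFormula.inf φ) Δ lo hi
  | iSup {n : ℕ} {φ : ℕ → PreFormula L n} {Δ : ℝ≥0 → ℝ≥0} {lo hi : ℝ} :
      (∀ k, Respects (φ k) Δ lo hi) → Respects (PreFormula.iSup φ) Δ lo hi
  | iInf {n : ℕ} {φ : ℕ → PreFormula L n} {Δ : ℝ≥0 → ℝ≥0} {lo hi : ℝ} :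
      (∀ k, Respects (φ k) Δ lo hi) → Respects (PreFormula.iInf φ) Δ lo hi
  | weaken {n : ℕ} {φ : PreFormula L n} {Δ Δ' : ℝ≥0 → ℝ≥0} {lo hi lo' hi' : ℝ} :
      Respects φ Δ lo hi → IsModulus Δ' → (∀ t, Δ t ≤ Δ' t) → lo' ≤ lo → hi ≤ hi' →
      Respects φ Δ' lo' hi'

/-- The formulas of infinitary continuous logic. -/
def IsFormula {n : ℕ} (φ : PreFormula L n) : Prop :=
  ∃ Δ lo hi, Respects φ Δ lo hi

/-- The interpretation of a formula. -/
noncomputable def eval (M : PolishStructure L) :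
    ∀ {n : ℕ}, PreFormula L n → (Fin n → M.carrier) → ℝ
  | _, one, _ => 1
  | _, atom R x, v => M.rel R (v ∘ x)
  | _, add φ ψ, v => φ.eval M v + ψ.eval M v
  | _, smul r φ, v => (r : ℝ) * φ.eval M v
  | _, max φ ψ, v => Max.max (φ.eval M v) (ψ.eval M v)
  | n, sup φ, v => ⨆ a : M.carrier, φ.eval M (Fin.snoc (α := fun _ : Fin (n + 1) => M.carrier) v a)
  | n, inf φ, v => ⨅ a : M.carrier, φ.eval M (Fin.snoc (α := fun _ : Fin (n + 1) => M.carrier) v a)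
  | _, iSup φ, v => ⨆ k, (φ k).eval M v
  | _, iInf φ, v => ⨅ k, (φ k).eval M v

/-- The extension of a substitution to one more (bound) variable. -/
def liftSubst {n m : ℕ} (f : Fin n → Fin m) : Fin (n + 1) → Fin (m + 1) :=
  Fin.snoc (α := fun _ : Fin (n + 1) => Fin (m + 1)) (fun i => (f i).castSucc) (Fin.last m)

/-- Substitution of terms (that is, of variables) for the free variables. -/
def subst : ∀ {n m : ℕ}, (Fin n → Fin m) → PreFormula L n → PreFormula L m
  | _, _, _, one => one
  | _, _, f, atom R x => atom R (f ∘ x)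
  | _, _, f, add φ ψ => add (φ.subst f) (ψ.subst f)
  | _, _, f, smul r φ => smul r (φ.subst f)
  | _, _, f, max φ ψ => max (φ.subst f) (ψ.subst f)
  | _, _, f, sup φ => sup (φ.subst (liftSubst f))
  | _, _, f, inf φ => inf (φ.subst (liftSubst f))
  | _, _, f, iSup φ => iSup (fun k => (φ k).subst f)
  | _, _, f, iInf φ => iInf (fun k => (φ k).subst f)

end PreFormula

/-- Fragments: countable sets of formulas that contain the atomic formulas and are closed under
finitary connectives (including the constant `1`), quantifiers, subformulas and substitution. -/
structure Fragment (L : Signature) where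
  carrier : ∀ n, Set (PreFormula L n)
  isFormula : ∀ {n} {φ : PreFormula L n}, φ ∈ carrier n → φ.IsFormula
  countable : ∀ n, (carrier n).Countable
  atom_mem : ∀ {n} (R : L.Rel) (x : Fin (L.arity R) → Fin n), PreFormula.atom R x ∈ carrier n
  one_mem : ∀ n, (PreFormula.one : PreFormula L n) ∈ carrier n
  add_mem_iff : ∀ {n} {φ ψ : PreFormula L n},
    PreFormula.add φ ψ ∈ carrier n ↔ φ ∈ carrier n ∧ ψ ∈ carrier n
  smul_mem_iff : ∀ {n} {r : ℚ} {φ : PreFormula L n},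
    PreFormula.smul r φ ∈ carrier n ↔ φ ∈ carrier n
  max_mem_iff : ∀ {n} {φ ψ : PreFormula L n},
    PreFormula.max φ ψ ∈ carrier n ↔ φ ∈ carrier n ∧ ψ ∈ carrier n
  sup_mem_iff : ∀ {n} {φ : PreFormula L (n + 1)},
    PreFormula.sup φ ∈ carrier n ↔ φ ∈ carrier (n + 1)
  inf_mem_iff : ∀ {n} {φ : PreFormula L (n + 1)},
    PreFormula.inf φ ∈ carrier n ↔ φ ∈ carrier (n + 1)
  of_iSup_mem : ∀ {n} {φ : ℕ → PreFormula L n},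
    PreFormula.iSup φ ∈ carrier n → ∀ k, φ k ∈ carrier n
  of_iInf_mem : ∀ {n} {φ : ℕ → PreFormula L n},
    PreFormula.iInf φ ∈ carrier n → ∀ k, φ k ∈ carrier n
  subst_mem : ∀ {n m} {φ : PreFormula L n} (f : Fin n → Fin m),
    φ ∈ carrier n → φ.subst f ∈ carrier m

/-- A sequence is tail-dense if each of its tails is dense. -/
def TailDense {X : Type} [TopologicalSpace X] (y : ℕ → X) : Prop :=
  ∀ N : ℕ, Dense (y '' {i | N ≤ i})

/-- The code in `∏ R, ℝ ^ (ℕ ^ arity R)` of a structure with a distinguished sequence. -/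
def code {L : Signature} (M : PolishStructure L) (y : ℕ → M.carrier) :
    ∀ R : L.Rel, (Fin (L.arity R) → ℕ) → ℝ :=
  fun R j => M.rel R (y ∘ j)

/-- The space `Mod(L)` of codes of Polish metric structures. -/
def Mod (L : Signature) : Type :=
  {ξ : ∀ R : L.Rel, (Fin (L.arity R) → ℕ) → ℝ //
    ∃ (M : PolishStructure L) (y : ℕ → M.carrier), TailDense y ∧ ξ = code M y}

namespace Mod

variable {L : Signature}

/-- The structure `M_ξ` coded by `ξ`. Together with its distinguished sequence `ξ.pt` it is
determined by `ξ` up to a unique isomorphism, so that its choice is immaterial. -/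
noncomputable def str (ξ : Mod L) : PolishStructure L := ξ.2.choose

/-- The distinguished tail-dense sequence of `M_ξ`. -/
noncomputable def pt (ξ : Mod L) : ℕ → ξ.str.carrier := ξ.2.choose_spec.choose

theorem tailDense_pt (ξ : Mod L) : TailDense ξ.pt := ξ.2.choose_spec.choose_spec.1

theorem code_pt (ξ : Mod L) : ξ.1 = code ξ.str ξ.pt := ξ.2.choose_spec.choose_spec.2

/-- The isomorphism class `[M]`. -/
def isoClass (M : Mod L) : Set (Mod L) := {N | Isomorphic M.str N.str}

end Mod

/-- The topology `t_F` on `Mod(L)`, generated by the sets `[φ(ā) < r]`. -/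
@[reducible] def fragmentTopology {L : Signature} (F : Fragment L) : TopologicalSpace (Mod L) :=
  TopologicalSpace.generateFrom
    {U | ∃ (n : ℕ) (φ : PreFormula L n) (a : Fin n → ℕ) (r : ℚ),
      φ ∈ F.carrier n ∧ U = {M : Mod L | φ.eval M.str (M.pt ∘ a) < (r : ℝ)}}

/-- The multiplicative Borel classes `𝚷⁰_α(t)`, `α ≥ 1`: `𝚷⁰_1` consists of the closed sets, and
for `α > 1` a set is in `𝚷⁰_α` iff it is a countable intersection of complements of
sets in `𝚷⁰_β`, `1 ≤ β < α`. -/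
inductive BoldPi {X : Type} (t : TopologicalSpace X) : Ordinal.{0} → Set X → Prop
  | closed {s : Set X} : @IsClosed X t s → BoldPi t 1 s
  | step {α : Ordinal.{0}} (hα : 1 < α) (β : ℕ → Ordinal.{0}) (s : ℕ → Set X)
      (hβ : ∀ n, 1 ≤ β n ∧ β n < α) (hs : ∀ n, BoldPi t (β n) (s n)) :
      BoldPi t α (⋂ n, (s n)ᶜ)

/-- The space `D(M)` of tail-dense sequences in `M`, a subspace of `M ^ ℕ`. -/
abbrev D {L : Signature} (M : PolishStructure L) : Type :=
  {y : ℕ → M.carrier // TailDense y}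

/-- The map `π` from `D(M)` to `Mod(L)` (onto `[M]`). -/
def toMod {L : Signature} {M : PolishStructure L} (y : D M) : Mod L :=
  ⟨code M y.1, M, y.1, y.2, rfl⟩

/-- The ball of radius `u` around the finite tuple `a` in `D(M)`; it is everything if `a` is the
empty tuple. -/
def seqBall {L : Signature} {M : PolishStructure L} {n : ℕ} (a : Fin n → M.carrier) (u : ℝ) :
    Set (D M) :=
  {y | ∀ i : Fin n, dist (y.1 i) (a i) < u}

/-- The Vaught transform `A^{*ā,u}`: the structures `M` such that `π(y) ∈ A` for comeagerly many
`y` in the ball of radius `u` around `ā` in `D(M)`. (The ball is open, so being meager in the ball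
and being meager in `D(M)` are the same for its subsets.) -/
def vaughtStar {L : Signature} (A : Set (Mod L)) {n : ℕ} (a : Fin n → ℕ) (u : ℝ) : Set (Mod L) :=
  {M | IsMeagre {y : D M.str | y ∈ seqBall (M.pt ∘ a) u ∧ toMod y ∉ A}}

/-- `TupleNear v b a`: `b` is in the ball of radius `v` around `a` in `X^{<ω}`; the distance of two
tuples only takes their common coordinates into account. -/
def TupleNear {X : Type} [MetricSpace X] (v : ℝ) {s n : ℕ} (b : Fin s → X) (a : Fin n → X) : Prop :=
  ∀ (i : ℕ) (hs : i < s) (hn : i < n), dist (b ⟨i, hs⟩) (a ⟨i, hn⟩) < v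

/-- `AEFamily F α n u`: the `α`-AE families `P(x̄)` over the fragment `F` with `|x̄| = n` and
`u_P = u`. The level `-1` is `⊥`. Families of level `-1` and `0` have no `u_P`; they are given
the dummy value `0`, which makes the requirement `u_P ≥ u_p` void for them. The ordinals `β + n`
with `n ≥ 2` and `β` zero or a limit are exactly those of the form `δ + 2`; a family of that level
is built from families of level `δ`, as in the constructor `addTwo`. -/
inductive AEFamily {L : Signature} (F : Fragment L) : WithBot Ordinal.{0} → ℕ → ℝ → Type 1
  | formula {n : ℕ} (φ : PreFormula L n) (hφ : φ ∈ F.carrier n) : AEFamily F ⊥ n 0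
  | zero {n : ℕ} (p : ℕ → AEFamily F ⊥ n 0) : AEFamily F ((0 : Ordinal.{0}) : WithBot Ordinal.{0}) n 0
  | limit {n : ℕ} {u : ℝ} (hu : 0 ≤ u) (β : Ordinal.{0}) (hβ : Order.IsSuccLimit β)
      (γ : ℕ → WithBot Ordinal.{0}) (hγ : ∀ k, γ k < (β : WithBot Ordinal.{0}))
      (w : ℕ → ℝ) (hw : ∀ k, w k ≤ u)
      (p : ∀ k, AEFamily F (γ k) n (w k)) :
      AEFamily F (β : WithBot Ordinal.{0}) n u
  | succ {n : ℕ} {u : ℝ} (hu : 0 ≤ u) (β : Ordinal.{0}) (hβ : β = 0 ∨ Order.IsSuccLimit β)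
      (γ : ℕ → ℕ → WithBot Ordinal.{0}) (hγ : ∀ k l, γ k l < (β : WithBot Ordinal.{0}))
      (m : ℕ → ℕ → ℕ) (hm : ∀ k l, n ≤ m k l)
      (w : ℕ → ℕ → ℝ) (hw : ∀ k l, w k l ≤ u)
      (p : ∀ k l, AEFamily F (γ k l) (m k l) (w k l)) :
      AEFamily F ((β + 1 : Ordinal.{0}) : WithBot Ordinal.{0}) n u
  | addTwo {n : ℕ} {u : ℝ} (hu : 0 ≤ u) (β : Ordinal.{0})
      (m : ℕ → ℕ → ℕ) (hm : ∀ k l, n ≤ m k l)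
      (w : ℕ → ℕ → ℝ) (hw : ∀ k l, w k l ≤ u)
      (p : ∀ k l, AEFamily F (β : WithBot Ordinal.{0}) (m k l) (w k l)) :
      AEFamily F ((β + 2 : Ordinal.{0}) : WithBot Ordinal.{0}) n u

namespace AEFamily

variable {L : Signature} {F : Fragment L}

/-- The tuple `a` in `M` realizes the AE family `P(x̄)`. -/
def Realizes (M : PolishStructure L) :
    ∀ {α : WithBot Ordinal.{0}} {n : ℕ} {u : ℝ}, AEFamily F α n u → (Fin n → M.carrier) → Prop
  | _, _, _, formula φ _, a => φ.eval M a = 0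
  | _, _, _, zero p, a => ∀ k, (p k).Realizes M a
  | _, _, _, limit _ _ _ _ _ _ _ p, a => ∀ k, (p k).Realizes M a
  | _, _, _, succ (u := u) _ _ _ _ _ m _ _ _ p, a =>
      ∀ (s : ℕ) (b : Fin s → M.carrier), TupleNear u b a → ∀ v : ℝ, 0 < v → ∀ k : ℕ,
        ∃ (l : ℕ) (c : Fin (m k l) → M.carrier), TupleNear v c b ∧ (p k l).Realizes M c
  | _, _, _, addTwo (u := u) _ _ m _ _ _ p, a =>
      ∀ (s : ℕ) (b : Fin s → M.carrier), TupleNear u b a → ∀ v : ℝ, 0 < v → ∀ k : ℕ,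
        ∃ (l : ℕ) (c : Fin (m k l) → M.carrier), TupleNear v c b ∧ (p k l).Realizes M c

/-- `M` models `P(∅)` if the empty tuple realizes it. -/
def IsModel {α : WithBot Ordinal.{0}} {u : ℝ} (P : AEFamily F α 0 u) (M : PolishStructure L) :
    Prop :=
  P.Realizes M Fin.elim0

end AEFamily

end MetricLogic

/-! ### Uniform continuity, bounds and invariance of formulas. -/

namespace MetricLogic

/-! For a fixed structure $M$, everything is pulled back along the continuous map $\pi$ to $D(M)$, a
dense $G_\delta$ in $M^{\mathbb N}$ and hence a Baire space. Borel sets pull back to sets with the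
Baire property.

The engine is `isMeagre_seqBall_diff_iff`. A set $\bigcap_k\bigcup_l E_{k,l}$ is comeagre in the
ball around $\bar a$ iff, for each $k$, every tuple $\bar b$ in that ball has arbitrarily near it a
tuple $\bar c$ such that some $E_{k,l}$ is comeagre in a small ball around $\bar c$. This is exactly
the quantifier pattern by which an AE family is realized. The base case is
`exists_formula_iff_isMeagre`: for a basic closed set, meagreness of the open difference means
emptiness, which one formula of the fragment expresses.

The induction `BoldPi.hasTransforms` peels off two Borel levels at once, writing a set of class
$1+\delta+2$ as $\bigcap\bigcup$ of sets of class $1+\delta$; at limits countable intersections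
suffice. The induction hypothesis also keeps the radius of the family at most that of the ball, so
that the requirement on $u_P$ is met.

The second part follows because the transform at the empty tuple fixes isomorphism classes
(`vaughtStar_isoClass`). -/

theorem IsModulus.le_of_le {Δ : ℝ≥0 → ℝ≥0} (h : IsModulus Δ) {r s : ℝ≥0} (hrs : r ≤ s) :
    Δ r ≤ Δ s := by
  obtain ⟨t, rfl⟩ := exists_add_of_le hrs
  exact h.mono r t

theorem isModulus_zero : IsModulus fun _ => 0 :=
  ⟨continuous_const, rfl, fun _ _ => le_rfl, fun _ _ => by simp⟩

theorem IsModulus.add {Δ Δ' : ℝ≥0 → ℝ≥0} (h : IsModulus Δ) (h' : IsModulus Δ') :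
    IsModulus fun t => Δ t + Δ' t :=
  ⟨h.continuous.add h'.continuous, by simp [h.map_zero, h'.map_zero],
    fun r s => add_le_add (h.mono r s) (h'.mono r s), fun r s =>
      (add_le_add (h.subadd r s) (h'.subadd r s)).trans_eq (add_add_add_comm _ _ _ _)⟩

theorem IsModulus.const_mul {Δ : ℝ≥0 → ℝ≥0} (h : IsModulus Δ) (c : ℝ≥0) :
    IsModulus fun t => c * Δ t :=
  ⟨continuous_const.mul h.continuous, by simp [h.map_zero],
    fun r s => mul_le_mul_right (h.mono r s) c, fun r s =>
      (mul_le_mul_right (h.subadd r s) c).trans_eq (mul_add _ _ _)⟩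

theorem IsModulus.max {Δ Δ' : ℝ≥0 → ℝ≥0} (h : IsModulus Δ) (h' : IsModulus Δ') :
    IsModulus fun t => max (Δ t) (Δ' t) :=
  ⟨h.continuous.max h'.continuous, by simp [h.map_zero, h'.map_zero],
    fun r s => max_le_max (h.mono r s) (h'.mono r s), fun r s =>
      max_le ((h.subadd r s).trans (add_le_add (le_max_left _ _) (le_max_left _ _)))
        ((h'.subadd r s).trans (add_le_add (le_max_right _ _) (le_max_right _ _)))⟩

theorem dist_ciSup_le {ι : Sort*} [Nonempty ι] {f g : ι → ℝ} {c : ℝ} (hf : BddAbove (Set.range f))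
    (hg : BddAbove (Set.range g)) (h : ∀ i, dist (f i) (g i) ≤ c) :
    dist (⨆ i, f i) (⨆ i, g i) ≤ c := by
  rw [Real.dist_eq, abs_le, neg_le_sub_iff_le_add, sub_le_iff_le_add]
  constructor <;> refine ciSup_le fun i => ?_
  · have := le_ciSup hf i
    have := abs_le.1 (h i)
    linarith
  · have := le_ciSup hg i
    have := abs_le.1 (h i)
    linarith

theorem dist_ciInf_le {ι : Sort*} [Nonempty ι] {f g : ι → ℝ} {c : ℝ} (hf : BddBelow (Set.range f))
    (hg : BddBelow (Set.range g)) (h : ∀ i, dist (f i) (g i) ≤ c) :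
    dist (⨅ i, f i) (⨅ i, g i) ≤ c := by
  rw [Real.dist_eq, abs_le, neg_le_sub_iff_le_add, sub_le_iff_le_add,
    ← sub_le_iff_le_add, ← sub_le_iff_le_add']
  constructor <;> refine le_ciInf fun i => ?_
  · have := ciInf_le hg i
    have := abs_le.1 (h i)
    linarith
  · have := ciInf_le hf i
    have := abs_le.1 (h i)
    linarith

namespace PreFormula

variable {L : Signature}

theorem Respects.isModulus {n : ℕ} {φ : PreFormula L n} {Δ : ℝ≥0 → ℝ≥0} {lo hi : ℝ}
    (h : φ.Respects Δ lo hi) : IsModulus Δ := by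
  induction h with
  | one => exact isModulus_zero
  | atom R x => exact L.isModulus R
  | add _ _ h h' => exact h.add h'
  | smul r _ h => exact h.const_mul _
  | max _ _ h h' => exact h.max h'
  | sup _ h => exact h
  | inf _ h => exact h
  | iSup _ h => exact h 0
  | iInf _ h => exact h 0
  | weaken _ h _ _ _ _ => exact h

/-- Nonemptiness matters for the quantifiers: the real supremum or infimum over an empty type is $0$
by convention and may lie outside the interval. -/
theorem Respects.eval_mem_Icc {n : ℕ} {φ : PreFormula L n} {Δ : ℝ≥0 → ℝ≥0} {lo hi : ℝ}
    (h : φ.Respects Δ lo hi) (M : PolishStructure L) [Nonempty M.carrier]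
    (v : Fin n → M.carrier) : φ.eval M v ∈ Set.Icc lo hi := by
  induction h with
  | one => simp [eval]
  | atom R x => exact M.bound R _
  | add _ _ h h' => exact ⟨add_le_add (h v).1 (h' v).1, add_le_add (h v).2 (h' v).2⟩
  | smul r _ h =>
    obtain ⟨h₁, h₂⟩ := h v
    simp only [eval]
    rcases le_total 0 (r : ℝ) with hr | hr
    · exact ⟨(min_le_left _ _).trans (mul_le_mul_of_nonneg_left h₁ hr),
        (mul_le_mul_of_nonneg_left h₂ hr).trans (le_max_right _ _)⟩
    · exact ⟨(min_le_right _ _).trans (mul_le_mul_of_nonpos_left h₂ hr),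
        (mul_le_mul_of_nonpos_left h₁ hr).trans (le_max_left _ _)⟩
  | max _ _ h h' => exact ⟨max_le_max (h v).1 (h' v).1, max_le_max (h v).2 (h' v).2⟩
  | sup _ h =>
    refine ⟨?_, ciSup_le fun a => (h _).2⟩
    exact (h _).1.trans (le_ciSup (f := fun a => eval M _ (Fin.snoc v a))
      ⟨_, Set.forall_mem_range.2 fun a => (h _).2⟩ (Classical.arbitrary M.carrier))
  | inf _ h =>
    refine ⟨le_ciInf fun a => (h _).1, ?_⟩
    exact (ciInf_le (f := fun a => eval M _ (Fin.snoc v a))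
      ⟨_, Set.forall_mem_range.2 fun a => (h _).1⟩ (Classical.arbitrary M.carrier)).trans (h _).2
  | iSup _ h =>
    refine ⟨?_, ciSup_le fun a => (h a v).2⟩
    exact (h 0 v).1.trans (le_ciSup (f := fun k => eval M _ v)
      ⟨_, Set.forall_mem_range.2 fun k => (h k v).2⟩ 0)
  | iInf _ h =>
    refine ⟨le_ciInf fun a => (h a v).1, ?_⟩
    exact (ciInf_le (f := fun k => eval M _ v)
      ⟨_, Set.forall_mem_range.2 fun k => (h k v).1⟩ 0).trans (h 0 v).2
  | weaken _ _ _ h₁ h₂ h => exact ⟨h₁.trans (h v).1, (h v).2.trans h₂⟩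

theorem nndist_comp_le {X : Type*} [PseudoMetricSpace X] {m n : ℕ} (v w : Fin n → X)
    (f : Fin m → Fin n) : nndist (v ∘ f) (w ∘ f) ≤ nndist v w :=
  nndist_pi_le_iff.2 fun i => nndist_le_pi_nndist v w (f i)

theorem nndist_snoc_le {X : Type*} [PseudoMetricSpace X] {n : ℕ} (v w : Fin n → X) (a : X) :
    nndist (Fin.snoc v a : Fin (n + 1) → X) (Fin.snoc w a) ≤ nndist v w := by
  refine nndist_pi_le_iff.2 fun i => ?_
  induction i using Fin.lastCases with
  | last => simp
  | cast i => simpa using nndist_le_pi_nndist v w i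

theorem Respects.dist_eval_le {n : ℕ} {φ : PreFormula L n} {Δ : ℝ≥0 → ℝ≥0} {lo hi : ℝ}
    (h : φ.Respects Δ lo hi) (M : PolishStructure L) [Nonempty M.carrier]
    (v w : Fin n → M.carrier) : dist (φ.eval M v) (φ.eval M w) ≤ Δ (nndist v w) := by
  induction h with
  | one => simp [eval]
  | atom R x =>
    have := (M.respects R (v ∘ x) (w ∘ x)).trans
      ((L.isModulus R).le_of_le (nndist_comp_le v w x))
    exact_mod_cast this
  | add _ _ h h' =>
    exact (dist_add_add_le _ _ _ _).trans (by push_cast; exact add_le_add (h v w) (h' v w))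
  | @smul n φ Δ lo hi r _ h =>
    simp only [eval, Real.dist_eq, ← mul_sub, abs_mul, NNReal.coe_mul, coe_nnnorm,
      Real.norm_eq_abs]
    exact mul_le_mul_of_nonneg_left (h v w) (abs_nonneg _)
  | max _ _ h h' =>
    simp only [eval, Real.dist_eq, NNReal.coe_max] at *
    exact (abs_max_sub_max_le_max _ _ _ _).trans (max_le_max (h v w) (h' v w))
  | sup hφ h =>
    have hb (v) : BddAbove (Set.range fun a : M.carrier => eval M _ (Fin.snoc v a)) :=
      ⟨_, Set.forall_mem_range.2 fun a => (hφ.eval_mem_Icc M _).2⟩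
    exact dist_ciSup_le (hb v) (hb w) fun a => (h _ _).trans
      (NNReal.coe_le_coe.2 (hφ.isModulus.le_of_le (nndist_snoc_le v w a)))
  | inf hφ h =>
    have hb (v) : BddBelow (Set.range fun a : M.carrier => eval M _ (Fin.snoc v a)) :=
      ⟨_, Set.forall_mem_range.2 fun a => (hφ.eval_mem_Icc M _).1⟩
    exact dist_ciInf_le (hb v) (hb w) fun a => (h _ _).trans
      (NNReal.coe_le_coe.2 (hφ.isModulus.le_of_le (nndist_snoc_le v w a)))
  | iSup hφ h =>
    exact dist_ciSup_le ⟨_, Set.forall_mem_range.2 fun k => ((hφ k).eval_mem_Icc M v).2⟩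
      ⟨_, Set.forall_mem_range.2 fun k => ((hφ k).eval_mem_Icc M w).2⟩ fun k => h k v w
  | iInf hφ h =>
    exact dist_ciInf_le ⟨_, Set.forall_mem_range.2 fun k => ((hφ k).eval_mem_Icc M v).1⟩
      ⟨_, Set.forall_mem_range.2 fun k => ((hφ k).eval_mem_Icc M w).1⟩ fun k => h k v w
  | weaken _ _ hle _ _ h => exact (h v w).trans (NNReal.coe_le_coe.2 (hle _))

theorem IsFormula.continuous_eval {n : ℕ} {φ : PreFormula L n} (h : φ.IsFormula)
    (M : PolishStructure L) [Nonempty M.carrier] : Continuous (φ.eval M) := by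
  obtain ⟨Δ, lo, hi, h⟩ := h
  refine continuous_iff_continuousAt.2 fun w => tendsto_iff_dist_tendsto_zero.2 ?_
  refine squeeze_zero (fun _ => dist_nonneg) (fun v => h.dist_eval_le M v w) ?_
  have hc : Continuous fun v : Fin n → M.carrier => (Δ (nndist v w) : ℝ) :=
    NNReal.continuous_coe.comp
      (h.isModulus.continuous.comp (continuous_id.nndist continuous_const))
  simpa [h.isModulus.map_zero] using hc.tendsto w

theorem IsFormula.bddAbove_range {n : ℕ} {φ : PreFormula L (n + 1)} (h : φ.IsFormula)
    (M : PolishStructure L) [Nonempty M.carrier] (v : Fin n → M.carrier) :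
    BddAbove (Set.range fun a => φ.eval M (Fin.snoc (α := fun _ => M.carrier) v a)) := by
  obtain ⟨Δ, lo, hi, h⟩ := h
  exact ⟨hi, Set.forall_mem_range.2 fun a => (h.eval_mem_Icc M _).2⟩

theorem snoc_comp_liftSubst {X : Type*} {n m : ℕ} (f : Fin n → Fin m) (v : Fin m → X) (a : X) :
    (Fin.snoc v a : Fin (m + 1) → X) ∘ liftSubst f = Fin.snoc (v ∘ f) a := by
  funext i
  induction i using Fin.lastCases with
  | last => simp [liftSubst]
  | cast i => simp [liftSubst]

theorem eval_subst (M : PolishStructure L) {n : ℕ} (φ : PreFormula L n) :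
    ∀ {m : ℕ} (f : Fin n → Fin m) (v : Fin m → M.carrier),
      (φ.subst f).eval M v = φ.eval M (v ∘ f) := by
  induction φ with
  | one => intros; rfl
  | atom R x => intros; rfl
  | add _ _ h h' => intros; simp [subst, eval, h, h']
  | smul r _ h => intros; simp [subst, eval, h]
  | max _ _ h h' => intros; simp [subst, eval, h, h']
  | sup _ h => intros; simp [subst, eval, h, snoc_comp_liftSubst]
  | inf _ h => intros; simp [subst, eval, h, snoc_comp_liftSubst]
  | iSup _ h => intros; simp [subst, eval, h]
  | iInf _ h => intros; simp [subst, eval, h]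

theorem eval_comp_equiv {M N : PolishStructure L} (e : M.carrier ≃ N.carrier)
    (he : ∀ R x, N.rel R (e ∘ x) = M.rel R x) {n : ℕ} (φ : PreFormula L n) :
    ∀ v : Fin n → M.carrier, φ.eval N (e ∘ v) = φ.eval M v := by
  induction φ with
  | one => intros; rfl
  | atom R x => intro v; exact he R (v ∘ x)
  | add _ _ h h' => intro v; simp only [eval, h, h']
  | smul r _ h => intro v; simp only [eval, h]
  | max _ _ h h' => intro v; simp only [eval, h, h']
  | sup _ h =>
    intro v
    exact (Equiv.iSup_congr e fun a => by rw [← Fin.comp_snoc, h]).symm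
  | inf _ h =>
    intro v
    exact (Equiv.iInf_congr e fun a => by rw [← Fin.comp_snoc, h]).symm
  | iSup _ h => intro v; simp only [eval, h]
  | iInf _ h => intro v; simp only [eval, h]

end PreFormula

/-! ### Isomorphisms, codes and continuity of the coding map. -/

variable {L : Signature}

theorem Isomorphic.symm {M N : PolishStructure L} (h : Isomorphic M N) : Isomorphic N M := by
  obtain ⟨e, he⟩ := h
  exact ⟨e.symm, fun R x => by rw [← he R (e.symm ∘ x)]; congr 1; funext i; simp⟩

theorem Isomorphic.trans {M N K : PolishStructure L} (h : Isomorphic M N) (h' : Isomorphic N K) :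
    Isomorphic M K := by
  obtain ⟨e, he⟩ := h
  obtain ⟨f, hf⟩ := h'
  exact ⟨e.trans f, fun R x => by rw [← he, ← hf]; rfl⟩

theorem TailDense.denseRange {X : Type} [TopologicalSpace X] {y : ℕ → X} (h : TailDense y) :
    DenseRange y := (h 0).mono (Set.image_subset_range _ _)

theorem continuous_rel (M : PolishStructure L) (R : L.Rel) : Continuous (M.rel R) := by
  refine continuous_iff_continuousAt.2 fun w => tendsto_iff_dist_tendsto_zero.2 ?_
  refine squeeze_zero (fun _ => dist_nonneg)
    (fun v => show dist _ _ ≤ (L.modulus R (nndist v w) : ℝ) from M.respects R v w) ?_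
  have hc : Continuous fun v : Fin (L.arity R) → M.carrier => (L.modulus R (nndist v w) : ℝ) :=
    NNReal.continuous_coe.comp
      ((L.isModulus R).continuous.comp (continuous_id.nndist continuous_const))
  simpa [(L.isModulus R).map_zero] using hc.tendsto w

theorem dist_eq_code (M : PolishStructure L) (y : ℕ → M.carrier) (i j : ℕ) :
    dist (y i) (y j) = code M y L.d (fun t => if (t : ℕ) = 0 then i else j) := by
  rw [← M.rel_d, code]
  congr 1
  funext t
  simp only [Function.comp_apply]
  split <;> rfl

/-- Both spaces are completions of the index set with the pulled-back pseudometric, so uniqueness of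
completions gives the map; it preserves distances on a dense set, hence everywhere. -/
theorem exists_isometryEquiv_of_dist_eq {ι X Y : Type} [MetricSpace X] [CompleteSpace X]
    [MetricSpace Y] [CompleteSpace Y] {x : ι → X} {y : ι → Y} (hx : DenseRange x)
    (hy : DenseRange y) (h : ∀ i j, dist (x i) (x j) = dist (y i) (y j)) :
    ∃ e : X ≃ᵢ Y, ∀ i, e (x i) = y i := by
  let U : PseudoMetricSpace ι := PseudoMetricSpace.induced x inferInstance
  have hxi : Isometry x := Isometry.of_dist_eq fun _ _ => rfl
  have hyi : Isometry y := Isometry.of_dist_eq fun i j => (h i j).symm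
  let p : AbstractCompletion ι :=
    ⟨X, x, inferInstance, inferInstance, inferInstance, hxi.isUniformInducing, hx⟩
  let q : AbstractCompletion ι :=
    ⟨Y, y, inferInstance, inferInstance, inferInstance, hyi.isUniformInducing, hy⟩
  let e : X ≃ᵤ Y := p.compareEquiv q
  have he (i) : e (x i) = y i := p.compare_coe q i
  refine ⟨⟨e.toEquiv, Isometry.of_dist_eq fun a b => ?_⟩, he⟩
  refine hx.induction_on₂ (p := fun a b => dist (e a) (e b) = dist a b) ?_ (fun i j => ?_) a b
  · exact isClosed_eq ((e.continuous.comp continuous_fst).dist (e.continuous.comp continuous_snd))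
      continuous_dist
  · rw [he, he, h]

/-- The code records all distances through the symbol `d`, which yields the isometry. The predicates
are continuous and agree on the dense set of tuples from the sequence. Hence the structure chosen
for a code can always be replaced by the one at hand. -/
theorem exists_equiv_of_code_eq {M N : PolishStructure L} {x : ℕ → M.carrier} {y : ℕ → N.carrier}
    (hx : TailDense x) (hy : TailDense y) (h : code M x = code N y) :
    ∃ e : M.carrier ≃ᵢ N.carrier, (∀ i, e (x i) = y i) ∧ ∀ R v, N.rel R (e ∘ v) = M.rel R v := by
  obtain ⟨e, he⟩ := exists_isometryEquiv_of_dist_eq hx.denseRange hy.denseRange fun i j => by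
    rw [dist_eq_code, dist_eq_code, h]
  refine ⟨e, he, fun R v => ?_⟩
  have hd : DenseRange fun j : Fin (L.arity R) → ℕ => x ∘ j := by
    have := DenseRange.piMap (ι := Fin (L.arity R)) fun _ => hx.denseRange
    exact this
  refine congrFun (hd.equalizer (g := fun v => N.rel R (e ∘ v)) (h := M.rel R) ?_
    (continuous_rel M R) (funext fun j => ?_)) v
  · exact (continuous_rel N R).comp
      (continuous_pi fun i => e.continuous.comp (continuous_apply i))
  · have : e ∘ x ∘ j = y ∘ j := funext fun i => he (j i)
    exact (congrArg (N.rel R) this).trans (congrFun (congrFun h R) j).symm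

theorem exists_equiv_toMod {M : PolishStructure L} (y : D M) :
    ∃ e : M.carrier ≃ᵢ (toMod y).str.carrier, (∀ i, e (y.1 i) = (toMod y).pt i) ∧
      ∀ R v, (toMod y).str.rel R (e ∘ v) = M.rel R v :=
  exists_equiv_of_code_eq y.2 (toMod y).tailDense_pt (toMod y).code_pt

theorem isomorphic_toMod {M : PolishStructure L} (y : D M) : Isomorphic M (toMod y).str := by
  obtain ⟨e, -, he⟩ := exists_equiv_toMod y
  exact ⟨e, he⟩

theorem eval_toMod {M : PolishStructure L} (y : D M) {n : ℕ} (φ : PreFormula L n)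
    (a : Fin n → ℕ) : φ.eval (toMod y).str ((toMod y).pt ∘ a) = φ.eval M (y.1 ∘ a) := by
  obtain ⟨e, hy, he⟩ := exists_equiv_toMod y
  rw [← PreFormula.eval_comp_equiv e.toEquiv he]
  congr 1
  funext i
  exact (hy (a i)).symm

theorem continuous_toMod (F : Fragment L) (M : PolishStructure L) :
    @Continuous _ _ _ (fragmentTopology F) (toMod : D M → Mod L) := by
  refine continuous_generateFrom_iff.2 ?_
  rintro _ ⟨n, φ, a, r, hφ, rfl⟩
  rcases isEmpty_or_nonempty M.carrier with h | h
  -- An empty structure carries no sequences, so the preimage is empty.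
  · have : IsEmpty (D M) := ⟨fun y => h.elim (y.1 0)⟩
    rw [Set.eq_empty_of_isEmpty (toMod ⁻¹' _)]
    exact isOpen_empty
  · simp only [Set.preimage_ofPred_eq, eval_toMod]
    refine isOpen_lt (((F.isFormula hφ).continuous_eval M).comp ?_) continuous_const
    exact continuous_pi fun i => (continuous_apply (a i)).comp continuous_subtype_val

end MetricLogic

/-! ### Baire category in the space of tail-dense sequences. -/

namespace MetricLogic

section TailDense

theorem exists_tailDense_extend {X : Type} [MetricSpace X] [TopologicalSpace.SeparableSpace X]
    (z : ℕ → X) (m : ℕ) : ∃ y : ℕ → X, TailDense y ∧ ∀ i < m, y i = z i := by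
  have : Nonempty X := ⟨z 0⟩
  -- Unpairing the index makes every term of a dense sequence recur infinitely often, so each tail
  -- is dense.
  refine ⟨fun i => if i < m then z i else TopologicalSpace.denseSeq X i.unpair.1, fun N => ?_,
    fun i hi => if_pos hi⟩
  refine (TopologicalSpace.denseRange_denseSeq X).mono ?_
  rintro _ ⟨k, rfl⟩
  have h := Nat.right_le_pair k (N + m)
  refine ⟨Nat.pair k (N + m), show N ≤ _ by omega, ?_⟩
  simp [show ¬ Nat.pair k (N + m) < m by omega]

theorem dense_setOf_tailDense (X : Type) [MetricSpace X] [TopologicalSpace.SeparableSpace X] :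
    Dense {y : ℕ → X | TailDense y} := by
  refine dense_iff_inter_open.2 fun U hU ⟨z, hz⟩ => ?_
  obtain ⟨I, u, hu, hIU⟩ := isOpen_pi_iff.1 hU z hz
  obtain ⟨m, hm⟩ := I.exists_nat_subset_range
  obtain ⟨y, hy, hyz⟩ := exists_tailDense_extend z m
  refine ⟨y, hIU fun i hi => ?_, hy⟩
  rw [hyz i (Finset.mem_range.1 (hm hi))]
  exact (hu i hi).2

theorem isGδ_setOf_tailDense (X : Type) [MetricSpace X] [TopologicalSpace.SeparableSpace X] :
    IsGδ {y : ℕ → X | TailDense y} := by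
  have : SecondCountableTopology X := UniformSpace.secondCountable_of_separable X
  have hb := TopologicalSpace.isBasis_countableBasis X
  have : {y : ℕ → X | TailDense y} = ⋂ N : ℕ, ⋂ o ∈ TopologicalSpace.countableBasis X,
      ⋃ i ∈ Set.Ici N, {y : ℕ → X | y i ∈ o} := by
    ext y
    simp only [TailDense, hb.dense_iff, Set.mem_ofPred_eq, Set.mem_iInter, Set.mem_iUnion]
    refine forall_congr' fun N => forall₂_congr fun o ho => ?_
    have hne := TopologicalSpace.nonempty_of_mem_countableBasis ho
    constructor
    · intro h
      obtain ⟨_, h, i, hi, rfl⟩ := h hne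
      exact ⟨i, hi, h⟩
    · rintro ⟨i, hi, h⟩ -
      exact ⟨_, h, i, hi, rfl⟩
  rw [this]
  refine .iInter fun N => .biInter (TopologicalSpace.countable_countableBasis X) fun o ho =>
    IsOpen.isGδ ?_
  exact isOpen_biUnion fun i _ =>
    (TopologicalSpace.isOpen_of_mem_countableBasis ho).preimage (continuous_apply i)

end TailDense

variable {L : Signature} {M : PolishStructure L}

instance : BaireSpace (D M) :=
  (isGδ_setOf_tailDense M.carrier).baireSpace_of_dense (dense_setOf_tailDense M.carrier)

theorem isOpen_seqBall {n : ℕ} (a : Fin n → M.carrier) (u : ℝ) : IsOpen (seqBall a u) := by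
  simp only [seqBall, Set.ofPred_forall]
  exact isOpen_iInter_of_finite fun i => isOpen_lt
    (((continuous_apply (i : ℕ)).comp continuous_subtype_val).dist continuous_const)
    continuous_const

/-- An open set in the product constrains finitely many coordinates. The length is taken at least
`n` because the members of an AE family must have at least the variables of the family. -/
theorem exists_seqBall_subset {O : Set (D M)} (hO : IsOpen O) {y : D M} (hy : y ∈ O) (n : ℕ) :
    ∃ (j : ℕ) (δ : ℝ), 0 < δ ∧ seqBall (fun i : Fin (n + j) => y.1 i) δ ⊆ O := by
  obtain ⟨U, hU, rfl⟩ := isOpen_induced_iff.1 hO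
  obtain ⟨I, u, hu, hIU⟩ := isOpen_pi_iff.1 hU y.1 hy
  obtain ⟨m, hm⟩ := I.exists_nat_subset_range
  choose! ε hε hball using fun i hi => Metric.isOpen_iff.1 (hu i hi).1 _ (hu i hi).2
  have h : ∀ᶠ δ in nhdsWithin (0 : ℝ) (Set.Ioi 0), ∀ i ∈ I, δ < ε i :=
    (Finset.eventually_all I).2 fun i hi =>
      nhdsWithin_le_nhds (eventually_lt_nhds (hε i hi))
  obtain ⟨δ, hδ, hδ'⟩ := (h.and self_mem_nhdsWithin).exists
  refine ⟨m, δ, hδ', fun x hx => hIU fun i hi => hball i hi ?_⟩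
  have him : i < n + m := by have := Finset.mem_range.1 (hm hi); omega
  exact (hx ⟨i, him⟩).trans (hδ i hi)

theorem exists_mem_D_eq [Nonempty M.carrier] {n : ℕ} (z : Fin n → M.carrier) :
    ∃ y : D M, ∀ i : Fin n, y.1 i = z i := by
  classical
  obtain ⟨y, hy, h⟩ := exists_tailDense_extend
    (fun i => if h : i < n then z ⟨i, h⟩ else Classical.arbitrary M.carrier) n
  exact ⟨⟨y, hy⟩, fun i => by simp [h i i.2]⟩

/-- The witness follows `b` as long as it lasts and then the rest of `a`; nearness is only needed on
the common coordinates. -/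
theorem seqBall_inter_nonempty [Nonempty M.carrier] {s n : ℕ} {b : Fin s → M.carrier}
    {a : Fin n → M.carrier} {u v : ℝ} (hu : 0 < u) (hv : 0 < v) (h : TupleNear u b a) :
    (seqBall b v ∩ seqBall a u).Nonempty := by
  classical
  obtain ⟨y, hy⟩ := exists_mem_D_eq (M := M) (n := s + n) fun i =>
    if h : i < s then b ⟨i, h⟩ else if h : i < n then a ⟨i, h⟩ else Classical.arbitrary M.carrier
  refine ⟨y, fun i => ?_, fun i => ?_⟩
  · simpa [hy ⟨i, by omega⟩] using hv
  · rw [hy ⟨i, by omega⟩]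
    by_cases hi : (i : ℕ) < s
    · simpa [hi] using h i hi i.2
    · simpa [hi] using hu

theorem tupleNear_of_mem_seqBall {n : ℕ} {a : Fin n → M.carrier} {u : ℝ} {y : D M}
    (hy : y ∈ seqBall a u) (m : ℕ) : TupleNear u (fun i : Fin m => y.1 i) a :=
  fun i _ hn => hy ⟨i, hn⟩

theorem isMeagre_diff_of_residualEq {X : Type*} [TopologicalSpace X] {s t : Set X}
    (h : s =ᶠ[residual X] t) : IsMeagre (s \ t) := by
  filter_upwards [Filter.eventuallyEq_set.1 h] with x hx
  simp [hx]

/-- The analysis of the Vaught transform of a set of the form `⋂ k, ⋃ l, E k l`. -/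
theorem isMeagre_seqBall_diff_iff [Nonempty M.carrier] {E : ℕ → ℕ → Set (D M)}
    (hE : ∀ k l, BaireMeasurableSet (E k l)) {n : ℕ} (a : Fin n → M.carrier) {u : ℚ}
    (hu : 0 < u) :
    IsMeagre (seqBall a u \ ⋂ k, ⋃ l, E k l) ↔
      ∀ (s : ℕ) (b : Fin s → M.carrier), TupleNear u b a → ∀ v : ℝ, 0 < v → ∀ k : ℕ,
        ∃ (l j : ℕ) (w : ℚ), 0 < w ∧ w ≤ u ∧ ∃ c : Fin (n + j) → M.carrier,
          TupleNear v c b ∧ IsMeagre (seqBall c w \ E k l) := by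
  have hu' : (0 : ℝ) < u := by exact_mod_cast hu
  constructor
  · intro hA s b hb v hv k
    let O := seqBall b v ∩ seqBall a u
    have hO : IsOpen O := (isOpen_seqBall b v).inter (isOpen_seqBall a u)
    have hOne : O.Nonempty := seqBall_inter_nonempty hu' hv hb
    obtain ⟨l, hl⟩ : ∃ l, ¬ IsMeagre (O ∩ E k l) := by
      -- Otherwise `O`, a nonempty open set, would be covered by countably many meagre sets.
      by_contra! h
      refine not_isMeagre_of_isOpen hO hOne ((hA.union (isMeagre_iUnion h)).mono fun y hy => ?_)
      by_cases hyE : y ∈ ⋃ l, E k l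
      · obtain ⟨l, hl⟩ := Set.mem_iUnion.1 hyE
        exact .inr (Set.mem_iUnion.2 ⟨l, hy, hl⟩)
      · exact .inl ⟨hy.2, fun h => hyE (Set.mem_iInter.1 h k)⟩
    -- By the Baire property `E k l` agrees with an open `U` up to a meagre set. It is therefore
    -- comeagre in every ball inside `U`, and `U` meets `O` since `O ∩ E k l` is nonmeagre.
    obtain ⟨U, hU, hEU⟩ := (hE k l).residualEq_isOpen
    obtain ⟨y, hyO, hyU⟩ : (O ∩ U).Nonempty := by
      by_contra! h
      refine hl ((isMeagre_diff_of_residualEq hEU).mono fun y hy => Set.mem_sdiff_of_mem hy.2 fun hyU => ?_)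
      exact Set.eq_empty_iff_forall_notMem.1 h y (Set.mem_inter hy.1 hyU)
    obtain ⟨j, δ, hδ, hball⟩ := exists_seqBall_subset (hO.inter hU) ⟨hyO, hyU⟩ n
    -- Keeping `w` below `u` is what later bounds the radii of the members by that of the family.
    obtain ⟨w, hw, hwδ⟩ := exists_rat_btwn (lt_min hδ hu')
    refine ⟨l, j, w, by exact_mod_cast hw, ?_, _, tupleNear_of_mem_seqBall hyO.1 _,
      (isMeagre_diff_of_residualEq hEU.symm).mono fun x hx => Set.mem_sdiff_of_mem (hball fun i => ?_).2 hx.2⟩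
    · exact_mod_cast (hwδ.trans_le (min_le_right _ _)).le
    · exact (hx.1 i).trans (hwδ.trans_le (min_le_left _ _))
  · intro H
    have hcover : seqBall a u \ ⋂ k, ⋃ l, E k l = ⋃ k, seqBall a u \ ⋃ l, E k l := by
      rw [Set.sdiff_iInter]
    rw [hcover]
    refine isMeagre_iUnion fun k => ?_
    -- If the part of the ball missed by the `k`-th union is nonmeagre, it is comeagre in some
    -- smaller ball. The hypothesis, applied to the centre of that ball, gives a ball meeting it in
    -- which some `E k l` is comeagre; the nonempty open intersection would then be meagre.
    by_contra hG
    have hGm : BaireMeasurableSet (seqBall a u \ ⋃ l, E k l) :=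
      (isOpen_seqBall a u).baireMeasurableSet.diff (.iUnion (hE k))
    obtain ⟨U, hU, hGU⟩ := hGm.residualEq_isOpen
    obtain ⟨y, hya, hyU⟩ : (seqBall a (u : ℝ) ∩ U).Nonempty := by
      by_contra! h
      refine hG ((isMeagre_diff_of_residualEq hGU).mono fun y hy => Set.mem_sdiff_of_mem hy fun hyU => ?_)
      exact Set.eq_empty_iff_forall_notMem.1 h y (Set.mem_inter hy.1 hyU)
    obtain ⟨j, δ, hδ, hball⟩ :=
      exists_seqBall_subset ((isOpen_seqBall a u).inter hU) ⟨hya, hyU⟩ n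
    obtain ⟨l, i, w, hw, -, c, hc, hcE⟩ := H _ _ (tupleNear_of_mem_seqBall hya (n + j)) δ hδ k
    have hw' : (0 : ℝ) < w := by exact_mod_cast hw
    refine not_isMeagre_of_isOpen ((isOpen_seqBall _ _).inter (isOpen_seqBall _ _))
      (seqBall_inter_nonempty hδ hw' hc)
      ((hcE.union (isMeagre_diff_of_residualEq hGU.symm)).mono fun x hx => ?_)
    by_cases hxE : x ∈ E k l
    · exact .inr ⟨(hball hx.2).2, fun hxG => hxG.2 (Set.mem_iUnion.2 ⟨l, hxE⟩)⟩
    · exact .inl ⟨hx.1, hxE⟩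

theorem BoldPi.measurableSet_preimage {X Y : Type} {t : TopologicalSpace X} [TopologicalSpace Y]
    {f : Y → X} (hf : Continuous f) {α : Ordinal.{0}} {s : Set X} (h : BoldPi t α s) :
    @MeasurableSet Y (borel Y) (f ⁻¹' s) := by
  borelize Y
  induction h with
  | closed hs => exact (hs.preimage hf).measurableSet
  | step _ _ _ _ _ ih =>
    rw [Set.preimage_iInter]
    exact .iInter fun n => (ih n).compl

theorem BoldPi.baireMeasurableSet_preimage {X Y : Type} {t : TopologicalSpace X}
    [TopologicalSpace Y] {f : Y → X} (hf : Continuous f) {α : Ordinal.{0}} {s : Set X}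
    (h : BoldPi t α s) : BaireMeasurableSet (f ⁻¹' s) := by
  borelize Y
  exact (h.measurableSet_preimage hf).baireMeasurableSet

end MetricLogic

/-! ### Formulas of the fragment and the closed sets they define. -/

namespace MetricLogic

variable {L : Signature}

section Definable

/-- `S` is the set of tuples at which some formula of the fragment `F` is at most `0`. -/
def Definable (F : Fragment L) {n : ℕ} (S : ∀ M : PolishStructure L, (Fin n → M.carrier) → Prop) :
    Prop :=
  ∃ φ ∈ F.carrier n, ∀ (M : PolishStructure L) [Nonempty M.carrier] (v : Fin n → M.carrier),
    φ.eval M v ≤ 0 ↔ S M v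

variable {F : Fragment L} {n m : ℕ}

theorem Definable.congr {S T : ∀ M : PolishStructure L, (Fin n → M.carrier) → Prop}
    (h : Definable F S) (hST : ∀ M v, S M v ↔ T M v) : Definable F T := by
  obtain ⟨φ, hφ, h⟩ := h
  exact ⟨φ, hφ, fun M _ v => (h M v).trans (hST M v)⟩

theorem Definable.comp {S : ∀ M : PolishStructure L, (Fin n → M.carrier) → Prop}
    (h : Definable F S) (f : Fin n → Fin m) : Definable F fun M v => S M (v ∘ f) := by
  obtain ⟨φ, hφ, h⟩ := h
  exact ⟨_, F.subst_mem f hφ, fun M _ v => by rw [PreFormula.eval_subst, h]⟩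

theorem Definable.or {S T : ∀ M : PolishStructure L, (Fin n → M.carrier) → Prop}
    (hS : Definable F S) (hT : Definable F T) : Definable F fun M v => S M v ∨ T M v := by
  obtain ⟨φ, hφ, h⟩ := hS
  obtain ⟨ψ, hψ, h'⟩ := hT
  -- This is the minimum of the two formulas, which is not a primitive connective.
  refine ⟨.smul (-1) (.max (.smul (-1) φ) (.smul (-1) ψ)), ?_, fun M _ v => ?_⟩
  · simp [F.smul_mem_iff, F.max_mem_iff, hφ, hψ]
  · show _ ↔ S M v ∨ T M v
    rw [← h, ← h']
    simp [PreFormula.eval]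

theorem Definable.false : Definable F (n := n) fun _ _ => False :=
  ⟨.one, F.one_mem n, fun M _ v => by simp [PreFormula.eval]⟩

theorem Definable.exists_fin {k : ℕ}
    {S : Fin k → ∀ M : PolishStructure L, (Fin n → M.carrier) → Prop}
    (h : ∀ i, Definable F (S i)) : Definable F fun M v => ∃ i, S i M v := by
  induction k with
  | zero => simpa using Definable.false
  | succ k ih => simpa only [Fin.exists_fin_succ] using (h 0).or (ih fun i => h i.succ)

theorem Definable.forall_snoc {S : ∀ M : PolishStructure L, (Fin (n + 1) → M.carrier) → Prop}
    (h : Definable F S) :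
    Definable F fun M v => ∀ a, S M (Fin.snoc (α := fun _ => M.carrier) v a) := by
  obtain ⟨φ, hφ, h⟩ := h
  refine ⟨.sup φ, F.sup_mem_iff.2 hφ, fun M _ v => ?_⟩
  simp only [← h]
  exact ciSup_le_iff ((F.isFormula hφ).bddAbove_range M v)

theorem Definable.forall_append {S : ∀ M : PolishStructure L, (Fin (n + m) → M.carrier) → Prop}
    (h : Definable F S) :
    Definable F fun M v => ∀ z : Fin m → M.carrier, S M (Fin.append v z) := by
  induction m with
  | zero =>
    refine h.congr fun M v => ?_
    have (z : Fin 0 → M.carrier) : Fin.append v z = v := funext fun i => Fin.append_left v z i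
    simp [this]
  | succ m ih =>
    refine (ih (h.forall_snoc (n := n + m))).congr fun M v => ⟨fun h z => ?_, fun h z a => ?_⟩
    · rw [← Fin.snoc_init_self z, Fin.append_snoc]
      exact h _ _
    · rw [← Fin.append_snoc]
      exact h _

theorem definable_le_dist (w : ℚ) (x y : Fin n) :
    Definable F fun _ v => (w : ℝ) ≤ dist (v x) (v y) := by
  refine ⟨.add (.smul w .one) (.smul (-1) (.atom L.d fun t => if (t : ℕ) = 0 then x else y)),
    ?_, fun M _ v => ?_⟩
  · simp [F.add_mem_iff, F.smul_mem_iff, F.one_mem, F.atom_mem]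
  · have : (v ∘ fun t : Fin (L.arity L.d) => if (t : ℕ) = 0 then x else y) =
        fun t : Fin (L.arity L.d) => if (t : ℕ) = 0 then v x else v y := by
      funext t
      simp only [Function.comp_apply]
      split <;> rfl
    simp [PreFormula.eval, this, M.rel_d]

end Definable

variable {F : Fragment L}

/-- The set of codes for which `φ` is at most `0` at the initial segment of the distinguished
sequence. -/
def basicClosed {m : ℕ} (φ : PreFormula L m) : Set (Mod L) :=
  {N | φ.eval N.str (fun i => N.pt i) ≤ 0}

/-- The sets `basicClosed φ` for `φ` in the fragment `F`. -/
def basicClosedSets (F : Fragment L) : Set (Set (Mod L)) :=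
  ⋃ m, basicClosed '' F.carrier m

theorem basicClosed_mem {m : ℕ} {φ : PreFormula L m} (hφ : φ ∈ F.carrier m) :
    basicClosed φ ∈ basicClosedSets F :=
  Set.mem_iUnion.2 ⟨m, φ, hφ, rfl⟩

theorem toMod_mem_basicClosed {M : PolishStructure L} {y : D M} {m : ℕ} {φ : PreFormula L m} :
    toMod y ∈ basicClosed φ ↔ φ.eval M (fun i => y.1 i) ≤ 0 := by
  have := eval_toMod y φ Fin.val
  exact iff_of_eq (congrArg (· ≤ 0) this)

theorem isClosed_of_mem_basicClosedSets {C : Set (Mod L)} (hC : C ∈ basicClosedSets F) :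
    @IsClosed _ (fragmentTopology F) C := by
  obtain ⟨m, φ, hφ, rfl⟩ := Set.mem_iUnion.1 hC
  let _ := fragmentTopology F
  refine isOpen_compl_iff.1 (.basic _ ⟨m, .smul (-1) φ, Fin.val, 0, F.smul_mem_iff.2 hφ, ?_⟩)
  ext N
  simp [basicClosed, PreFormula.eval, Function.comp_def]

theorem countable_basicClosedSets (F : Fragment L) : (basicClosedSets F).Countable :=
  Set.countable_iUnion fun m => (F.countable m).image _

/-- Closure of the fragment under substitution, rational shifts and maxima turns the generating sets
into a base of sets $\phi<0$, with $\phi$ evaluated at an initial segment of the sequence. -/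
theorem exists_formula_of_mem_isOpen {U : Set (Mod L)} (hU : @IsOpen _ (fragmentTopology F) U)
    {N : Mod L} (hN : N ∈ U) : ∃ m, ∃ φ ∈ F.carrier m,
      φ.eval N.str (fun i => N.pt i) < 0 ∧
        ∀ K : Mod L, φ.eval K.str (fun i => K.pt i) < 0 → K ∈ U := by
  induction hU with
  | basic U hU =>
    obtain ⟨n, φ, a, r, hφ, rfl⟩ := hU
    obtain ⟨m, hm⟩ := (Set.finite_range a).bddAbove
    let f : Fin n → Fin (m + 1) := fun i => ⟨a i, Nat.lt_succ_of_le (hm ⟨i, rfl⟩)⟩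
    have key (K : Mod L) : (PreFormula.add (φ.subst f) (.smul (-r) .one)).eval K.str
        (fun i => K.pt i) < 0 ↔ φ.eval K.str (K.pt ∘ a) < (r : ℝ) := by
      simp only [PreFormula.eval, PreFormula.eval_subst, Rat.cast_neg, mul_one,
        ← sub_eq_add_neg, sub_neg]
      rfl
    exact ⟨m + 1, _, F.add_mem_iff.2 ⟨F.subst_mem f hφ, F.smul_mem_iff.2 (F.one_mem _)⟩,
      (key N).2 hN, fun K => (key K).1⟩
  | univ =>
    exact ⟨0, .smul (-1) .one, F.smul_mem_iff.2 (F.one_mem _), by simp [PreFormula.eval],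
      fun _ _ => trivial⟩
  | inter U V _ _ ihU ihV =>
    obtain ⟨m, φ, hφ, hφN, hφU⟩ := ihU hN.1
    obtain ⟨k, ψ, hψ, hψN, hψV⟩ := ihV hN.2
    have key (K : Mod L) : (PreFormula.max (φ.subst (Fin.castLE (le_max_left m k)))
        (ψ.subst (Fin.castLE (le_max_right m k)))).eval K.str (fun i => K.pt i) < 0 ↔
          φ.eval K.str (fun i => K.pt i) < 0 ∧ ψ.eval K.str (fun i => K.pt i) < 0 := by
      simp only [PreFormula.eval, PreFormula.eval_subst, max_lt_iff]
      rfl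
    exact ⟨_, _, F.max_mem_iff.2 ⟨F.subst_mem _ hφ, F.subst_mem _ hψ⟩, (key N).2 ⟨hφN, hψN⟩,
      fun K hK => ⟨hφU K ((key K).1 hK).1, hψV K ((key K).1 hK).2⟩⟩
  | sUnion S _ ih =>
    obtain ⟨U, hU, hNU⟩ := hN
    obtain ⟨m, φ, hφ, hφN, hφU⟩ := ih U hU hNU
    exact ⟨m, φ, hφ, hφN, fun K hK => ⟨U, hU, hφU K hK⟩⟩

/-- Around each point, a neighbourhood $\phi<0$ shrinks to some $\phi\le q$ with $q<0$ rational, and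
the fragment supplies only countably many such sets. -/
theorem exists_eq_iUnion_of_isOpen {U : Set (Mod L)} (hU : @IsOpen _ (fragmentTopology F) U) :
    ∃ C : ℕ → Set (Mod L), (∀ l, C l ∈ basicClosedSets F) ∧ U = ⋃ l, C l := by
  -- The constant $1$ defines the empty set, so an enumeration by `ℕ` exists even for empty `U`.
  have hne : {C ∈ basicClosedSets F | C ⊆ U}.Nonempty :=
    ⟨_, basicClosed_mem (F.one_mem 0), fun N hN => by
      simp [basicClosed, PreFormula.eval, not_le_of_gt one_pos] at hN⟩
  obtain ⟨C, hC⟩ := ((countable_basicClosedSets F).mono (Set.sep_subset _ _)).exists_eq_range hne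
  have hC' (l) : C l ∈ basicClosedSets F ∧ C l ⊆ U := by
    have : C l ∈ {C ∈ basicClosedSets F | C ⊆ U} := hC ▸ Set.mem_range_self l
    exact this
  refine ⟨C, fun l => (hC' l).1, Set.Subset.antisymm (fun N hN => ?_)
    (Set.iUnion_subset fun l => (hC' l).2)⟩
  obtain ⟨m, φ, hφ, hφN, hφU⟩ := exists_formula_of_mem_isOpen hU hN
  obtain ⟨q, hq, hq0⟩ := exists_rat_btwn hφN
  have hψ : PreFormula.add φ (.smul (-q) .one) ∈ F.carrier m :=
    F.add_mem_iff.2 ⟨hφ, F.smul_mem_iff.2 (F.one_mem _)⟩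
  have key (K : Mod L) : K ∈ basicClosed (PreFormula.add φ (.smul (-q) .one)) ↔
      φ.eval K.str (fun i => K.pt i) ≤ q := by
    simp [basicClosed, PreFormula.eval]
  have hmem : basicClosed (PreFormula.add φ (.smul (-q) .one)) ∈ Set.range C :=
    hC ▸ ⟨basicClosed_mem hψ, fun K hK => hφU K (((key K).1 hK).trans_lt hq0)⟩
  obtain ⟨l, hl⟩ := hmem
  exact Set.mem_iUnion.2 ⟨l, hl ▸ (key N).2 hq.le⟩

theorem exists_eq_iInter_of_isClosed {A : Set (Mod L)}
    (hA : @IsClosed _ (fragmentTopology F) A) :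
    ∃ C : ℕ → Set (Mod L), (∀ l, C l ∈ basicClosedSets F) ∧ A = ⋂ l, C l := by
  have hne : {C ∈ basicClosedSets F | A ⊆ C}.Nonempty :=
    ⟨_, basicClosed_mem (F.smul_mem_iff (r := -1).2 (F.one_mem 0)), fun N _ => by
      simp [basicClosed, PreFormula.eval]⟩
  obtain ⟨C, hC⟩ := ((countable_basicClosedSets F).mono (Set.sep_subset _ _)).exists_eq_range hne
  have hC' (l) : C l ∈ basicClosedSets F ∧ A ⊆ C l := by
    have : C l ∈ {C ∈ basicClosedSets F | A ⊆ C} := hC ▸ Set.mem_range_self l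
    exact this
  refine ⟨C, fun l => (hC' l).1, Set.Subset.antisymm (Set.subset_iInter fun l => (hC' l).2)
    fun N hN => ?_⟩
  by_contra hNA
  obtain ⟨m, φ, hφ, hφN, hφU⟩ := exists_formula_of_mem_isOpen hA.isOpen_compl hNA
  have key (K : Mod L) : K ∈ basicClosed (PreFormula.smul (-1) φ) ↔
      0 ≤ φ.eval K.str (fun i => K.pt i) := by
    simp [basicClosed, PreFormula.eval]
  have hmem : basicClosed (PreFormula.smul (-1) φ) ∈ Set.range C :=
    hC ▸ ⟨basicClosed_mem (F.smul_mem_iff.2 hφ), fun K hK => (key K).2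
      (not_lt.1 fun h => hφU K h hK)⟩
  obtain ⟨l, hl⟩ := hmem
  exact hφN.not_ge ((key N).1 (hl ▸ Set.mem_iInter.1 hN l))

/-- The Vaught transform of a basic closed set is the zero set of a formula in the fragment. -/
theorem exists_formula_iff_isMeagre {C : Set (Mod L)} (hC : C ∈ basicClosedSets F) (n : ℕ)
    {w : ℚ} (hw : 0 < w) :
    ∃ ψ ∈ F.carrier n, ∀ (M : PolishStructure L) [Nonempty M.carrier] (a : Fin n → M.carrier),
      IsMeagre (seqBall a w \ (toMod ⁻¹' C : Set (D M))) ↔ ψ.eval M a = 0 := by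
  have hcl := isClosed_of_mem_basicClosedSets hC
  obtain ⟨m, φ, hφ, rfl⟩ := Set.mem_iUnion.1 hC
  -- The variables are `a` followed by a tuple `z` of length `n + m`, long enough to decide both
  -- membership in the ball (first `n` entries) and `φ` (first `m` entries). The condition says that
  -- `φ` holds at `z` or `z` lies outside the ball; quantifying over all `z` is then a supremum.
  have hS : Definable F (n := n + (n + m)) fun M v =>
      φ.eval M (v ∘ Fin.natAdd n ∘ Fin.castLE (Nat.le_add_left m n)) ≤ 0 ∨
        ∃ i : Fin n, (w : ℝ) ≤ dist (v (Fin.natAdd n (Fin.castAdd m i))) (v (Fin.castAdd _ i)) :=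
    .or (.comp ⟨φ, hφ, fun _ _ _ => Iff.rfl⟩ _) (.exists_fin fun i => definable_le_dist w _ _)
  obtain ⟨χ, hχ, h⟩ := hS.forall_append
  -- The maximum with $0$ turns the condition $\le 0$ into $=0$.
  refine ⟨.max χ (.smul 0 .one), F.max_mem_iff.2 ⟨hχ, F.smul_mem_iff.2 (F.one_mem n)⟩,
    fun M _ a => ?_⟩
  have hw' : (0 : ℝ) < w := by exact_mod_cast hw
  -- In a Baire space an open set is meagre only if it is empty, so category disappears from the
  -- statement.
  have hO : IsOpen (seqBall a w \ (toMod ⁻¹' basicClosed φ : Set (D M))) := by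
    refine (isOpen_seqBall a w).sdiff ?_
    let _ := fragmentTopology F
    exact hcl.preimage (continuous_toMod F M)
  have hχ0 : (PreFormula.max χ (.smul 0 .one)).eval M a = 0 ↔ χ.eval M a ≤ 0 := by
    simp [PreFormula.eval]
  rw [hχ0, h]
  simp only [Fin.append_left, Fin.append_right]
  constructor
  · intro hm z
    by_contra! hz
    obtain ⟨y, hy⟩ := exists_mem_D_eq z
    refine not_isMeagre_of_isOpen hO ⟨y, fun i => ?_, fun hyC => ?_⟩ hm
    · simpa [← hy] using hz.2 i
    · rw [Set.mem_preimage, toMod_mem_basicClosed] at hyC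
      refine hz.1.not_ge (le_of_eq_of_le ?_ hyC)
      congr 1
      funext i
      simp [← hy]
  · intro hz
    convert IsMeagre.empty
    refine Set.eq_empty_of_forall_notMem fun y hy => hy.2 ?_
    rw [Set.mem_preimage, toMod_mem_basicClosed]
    rcases hz fun i => y.1 i with h | ⟨i, hi⟩
    · refine le_of_eq_of_le ?_ h
      congr 1
      funext i
      simp
    · exact absurd (hy.1 i) hi.not_gt

end MetricLogic

/-! ### The Borel hierarchy and the induction on levels. -/

namespace MetricLogic

variable {L : Signature} {F : Fragment L}

section BoldPi

theorem BoldPi.isClosed {X : Type} {t : TopologicalSpace X} {s : Set X} (h : BoldPi t 1 s) :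
    @IsClosed X t s := by
  cases h with
  | closed h => exact h
  | step h => exact absurd h (lt_irrefl _)

theorem BoldPi.exists_eq_iInter_compl {X : Type} {t : TopologicalSpace X} {α : Ordinal.{0}}
    {s : Set X} (h : BoldPi t α s) (hα : 1 < α) :
    ∃ (β : ℕ → Ordinal.{0}) (r : ℕ → Set X), (∀ n, 1 ≤ β n ∧ β n < α) ∧
      (∀ n, BoldPi t (β n) (r n)) ∧ s = ⋂ n, (r n)ᶜ := by
  cases h with
  | closed => exact absurd hα (lt_irrefl _)
  | step _ β r hβ hr => exact ⟨β, r, hβ, hr, rfl⟩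

theorem BoldPi.compl {X : Type} {t : TopologicalSpace X} {α : Ordinal.{0}} {s : Set X}
    (h : BoldPi t α s) (hα : 1 ≤ α) : BoldPi t (α + 1) sᶜ := by
  have hlt : α < α + 1 := Order.lt_succ α
  have := BoldPi.step (hα.trans_lt hlt) (fun _ => α) (fun _ => s) (fun _ => ⟨hα, hlt⟩) fun _ => h
  simpa only [Set.iInter_const] using this

/-- This can fail in a general topology; here closed sets are $G_\delta$, because open sets are
countable unions of basic closed ones. -/
theorem BoldPi.mono {α β : Ordinal.{0}} {s : Set (Mod L)} (h : BoldPi (fragmentTopology F) α s)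
    (hαβ : α ≤ β) : BoldPi (fragmentTopology F) β s := by
  rcases hαβ.eq_or_lt with rfl | hlt
  · exact h
  cases h with
  | closed hs =>
    obtain ⟨C, hC, hU⟩ := exists_eq_iUnion_of_isOpen hs.isOpen_compl
    rw [compl_eq_comm, Set.compl_iUnion] at hU
    exact hU ▸ .step hlt (fun _ => 1) C (fun _ => ⟨le_rfl, hlt⟩)
      fun l => .closed (isClosed_of_mem_basicClosedSets (hC l))
  | step hα γ r hγ hr =>
    exact .step (hα.trans hlt) γ r (fun n => ⟨(hγ n).1, (hγ n).2.trans hlt⟩) hr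

end BoldPi

/-- The Vaught transforms of `A` are given by `α`-AE families, with the radius of the ball bounding
the radius of the family. -/
def HasTransforms (F : Fragment L) (α : WithBot Ordinal.{0}) (A : Set (Mod L)) : Prop :=
  ∀ (n : ℕ) (w : ℚ), 0 < w → ∃ r : ℝ, r ≤ w ∧ ∃ P : AEFamily F α n r,
    ∀ (M : PolishStructure L) [Nonempty M.carrier] (a : Fin n → M.carrier),
      IsMeagre (seqBall a w \ (toMod ⁻¹' A : Set (D M))) ↔ P.Realizes M a

theorem hasTransforms_of_mem_basicClosedSets {C : Set (Mod L)} (hC : C ∈ basicClosedSets F) :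
    HasTransforms F ⊥ C := by
  intro n w hw
  obtain ⟨ψ, hψ, h⟩ := exists_formula_iff_isMeagre hC n hw
  exact ⟨0, by exact_mod_cast hw.le, .formula ψ hψ, h⟩

theorem isMeagre_diff_iInter {X : Type*} [TopologicalSpace X] {s : Set X} {t : ℕ → Set X} :
    IsMeagre (s \ ⋂ k, t k) ↔ ∀ k, IsMeagre (s \ t k) := by
  rw [Set.sdiff_iInter]
  exact ⟨fun h k => h.mono (Set.subset_iUnion (fun k => s \ t k) k), isMeagre_iUnion⟩

theorem hasTransforms_of_isClosed {A : Set (Mod L)} (hA : @IsClosed _ (fragmentTopology F) A) :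
    HasTransforms F ((0 : Ordinal.{0}) : WithBot Ordinal.{0}) A := by
  intro n w hw
  obtain ⟨C, hC, rfl⟩ := exists_eq_iInter_of_isClosed hA
  choose ψ hψ h using fun l => exists_formula_iff_isMeagre (hC l) n hw
  refine ⟨0, by exact_mod_cast hw.le, .zero fun l => .formula (ψ l) (hψ l), fun M _ a => ?_⟩
  rw [Set.preimage_iInter, isMeagre_diff_iInter]
  exact forall_congr' fun l => h l M a

theorem hasTransforms_iInter_of_isSuccLimit {β : Ordinal.{0}} (hβ : Order.IsSuccLimit β)
    {γ : ℕ → WithBot Ordinal.{0}} (hγ : ∀ k, γ k < (β : WithBot Ordinal.{0}))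
    {A : ℕ → Set (Mod L)} (hA : ∀ k, HasTransforms F (γ k) (A k)) :
    HasTransforms F β (⋂ k, A k) := by
  intro n w hw
  choose r hr P hP using fun k => hA k n w hw
  refine ⟨w, le_rfl, .limit (by exact_mod_cast hw.le) β hβ γ hγ r hr P, fun M _ a => ?_⟩
  rw [Set.preimage_iInter, isMeagre_diff_iInter]
  exact forall_congr' fun k => hP k M a

/-- The category criterion asks for a set index, an extension length and a rational radius at most
`u`. One enumeration of these triples by `ℕ` makes them the single index of an AE family; `ι`
recovers the set index. -/
theorem exists_families_iInter_iUnion {γ : ℕ → ℕ → WithBot Ordinal.{0}} {A : ℕ → ℕ → Set (Mod L)}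
    (hA : ∀ k l, HasTransforms F (γ k l) (A k l))
    (hAm : ∀ k l, ∃ δ, BoldPi (fragmentTopology F) δ (A k l)) (n : ℕ) {u : ℚ} (hu : 0 < u) :
    ∃ (ι : ℕ → ℕ) (m : ℕ → ℕ → ℕ) (w : ℕ → ℕ → ℝ)
      (p : ∀ k l, AEFamily F (γ k (ι l)) (m k l) (w k l)),
      (∀ k l, n ≤ m k l) ∧ (∀ k l, w k l ≤ u) ∧
      ∀ (M : PolishStructure L) [Nonempty M.carrier] (a : Fin n → M.carrier),
        IsMeagre (seqBall a u \ (toMod ⁻¹' ⋂ k, ⋃ l, A k l : Set (D M))) ↔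
          ∀ (s : ℕ) (b : Fin s → M.carrier), TupleNear u b a → ∀ v : ℝ, 0 < v → ∀ k : ℕ,
            ∃ (l : ℕ) (c : Fin (m k l) → M.carrier), TupleNear v c b ∧ (p k l).Realizes M c := by
  have : Nonempty {q : ℚ // 0 < q ∧ q ≤ u} := ⟨⟨u, hu, le_rfl⟩⟩
  obtain ⟨e, he⟩ := exists_surjective_nat (ℕ × ℕ × {q : ℚ // 0 < q ∧ q ≤ u})
  choose r hr P hP using fun k i =>
    hA k (e i).1 (n + (e i).2.1) (e i).2.2.1 (e i).2.2.2.1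
  refine ⟨fun i => (e i).1, fun _ i => n + (e i).2.1, r, P, fun k i => Nat.le_add_right _ _,
    fun k i => (hr k i).trans (by exact_mod_cast (e i).2.2.2.2), fun M _ a => ?_⟩
  let _ := fragmentTopology F
  have hE (k l) : BaireMeasurableSet (toMod ⁻¹' A k l : Set (D M)) :=
    (hAm k l).choose_spec.baireMeasurableSet_preimage (continuous_toMod F M)
  simp only [Set.preimage_iInter, Set.preimage_iUnion]
  rw [isMeagre_seqBall_diff_iff hE a hu]
  refine forall_congr' fun s => forall_congr' fun b => forall_congr' fun _ => forall_congr' fun v =>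
    forall_congr' fun _ => forall_congr' fun k => ⟨?_, ?_⟩
  · rintro ⟨l, j, w, hw, hwu, c, hc, hm⟩
    obtain ⟨i, hi⟩ := he (l, j, ⟨w, hw, hwu⟩)
    have : ∃ c : Fin (n + (e i).2.1) → M.carrier, TupleNear v c b ∧
        IsMeagre (seqBall c (e i).2.2.1 \ (toMod ⁻¹' A k (e i).1 : Set (D M))) := by
      rw [hi]
      exact ⟨c, hc, hm⟩
    obtain ⟨c, hc, hm⟩ := this
    exact ⟨i, c, hc, (hP k i M c).1 hm⟩
  · rintro ⟨i, c, hc, hm⟩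
    exact ⟨_, _, _, (e i).2.2.2.1, (e i).2.2.2.2, c, hc, (hP k i M c).2 hm⟩

theorem hasTransforms_iInter_iUnion_succ {β : Ordinal.{0}} (hβ : β = 0 ∨ Order.IsSuccLimit β)
    {γ : ℕ → ℕ → WithBot Ordinal.{0}} (hγ : ∀ k l, γ k l < (β : WithBot Ordinal.{0}))
    {A : ℕ → ℕ → Set (Mod L)} (hA : ∀ k l, HasTransforms F (γ k l) (A k l))
    (hAm : ∀ k l, ∃ δ, BoldPi (fragmentTopology F) δ (A k l)) :
    HasTransforms F ((β + 1 : Ordinal.{0}) : WithBot Ordinal.{0}) (⋂ k, ⋃ l, A k l) := by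
  intro n u hu
  obtain ⟨ι, m, w, p, hm, hw, h⟩ := exists_families_iInter_iUnion hA hAm n hu
  have hu0 : (0 : ℝ) ≤ u := by exact_mod_cast hu.le
  exact ⟨u, le_rfl, .succ hu0 β hβ _ (fun k l => hγ k (ι l)) m hm w hw p, h⟩

theorem hasTransforms_iInter_iUnion_addTwo {β : Ordinal.{0}} {A : ℕ → ℕ → Set (Mod L)}
    (hA : ∀ k l, HasTransforms F β (A k l))
    (hAm : ∀ k l, ∃ δ, BoldPi (fragmentTopology F) δ (A k l)) :
    HasTransforms F ((β + 2 : Ordinal.{0}) : WithBot Ordinal.{0}) (⋂ k, ⋃ l, A k l) := by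
  intro n u hu
  obtain ⟨ι, m, w, p, hm, hw, h⟩ :=
    exists_families_iInter_iUnion (γ := fun _ _ => (β : WithBot Ordinal.{0})) hA hAm n hu
  have hu0 : (0 : ℝ) ≤ u := by exact_mod_cast hu.le
  exact ⟨u, le_rfl, .addTwo hu0 β m hm w hw p, h⟩

theorem one_add_of_isSuccLimit {β : Ordinal.{0}} (hβ : Order.IsSuccLimit β) : 1 + β = β :=
  Ordinal.one_add_of_omega0_le (Ordinal.omega0_le_of_isSuccLimit hβ)

/-- The cases follow the constructors of AE families: level $0$, limits, successors of $0$ or a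
limit, and double successors. At limits the shift $1+\alpha$ is absorbed. -/
theorem BoldPi.hasTransforms (α : Ordinal.{0}) :
    ∀ {A : Set (Mod L)}, BoldPi (fragmentTopology F) (1 + α) A → HasTransforms F α A := by
  induction α using WellFoundedLT.induction with
  | ind α ih =>
  intro A hA
  have le_one_add (γ : Ordinal.{0}) : γ ≤ 1 + γ := le_add_self
  rcases Ordinal.zero_or_succ_or_isSuccLimit α with rfl | ⟨β, rfl⟩ | hα
  · exact hasTransforms_of_isClosed (by simpa using hA : BoldPi (fragmentTopology F) 1 A).isClosed
  · rw [Order.succ_eq_add_one] at *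
    have hlt : 1 < 1 + (β + 1) := by
      rw [← add_assoc]
      exact (le_self_add : (1 : Ordinal) ≤ 1 + β).trans_lt (Order.lt_succ _)
    obtain ⟨β', s, hβ', hs, rfl⟩ := hA.exists_eq_iInter_compl hlt
    replace hs (k) : BoldPi (fragmentTopology F) (1 + β) (s k) :=
      (hs k).mono (Order.lt_succ_iff.1 ((hβ' k).2.trans_eq (add_assoc _ _ _).symm))
    rcases Ordinal.zero_or_succ_or_isSuccLimit β with rfl | ⟨δ, rfl⟩ | hβ
    · simp only [add_zero] at hs
      choose C hC h using fun k => exists_eq_iUnion_of_isOpen (hs k).isClosed.isOpen_compl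
      simp only [h]
      -- The complements are open, hence unions of basic closed sets, whose transforms are single
      -- formulas, of level `⊥`.
      exact hasTransforms_iInter_iUnion_succ (γ := fun _ _ => ⊥) (.inl rfl)
        (fun _ _ => WithBot.bot_lt_coe _) (fun k l => hasTransforms_of_mem_basicClosedSets (hC k l))
        fun k l => ⟨1, .closed (isClosed_of_mem_basicClosedSets (hC k l))⟩
    · rw [Order.succ_eq_add_one] at *
      have hlt : 1 < 1 + (δ + 1) := by
        rw [← add_assoc]
        exact (le_self_add : (1 : Ordinal) ≤ 1 + δ).trans_lt (Order.lt_succ _)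
      choose γ r hγ hr h using fun k => (hs k).exists_eq_iInter_compl hlt
      simp only [h, Set.compl_iInter, compl_compl]
      have hr' (k l) : BoldPi (fragmentTopology F) (1 + δ) (r k l) :=
        (hr k l).mono (Order.lt_succ_iff.1 ((hγ k l).2.trans_eq (add_assoc _ _ _).symm))
      have hδ : δ < δ + 1 + 1 := (Order.lt_succ δ).trans (Order.lt_succ _)
      have := hasTransforms_iInter_iUnion_addTwo (fun k l => ih δ hδ (hr' k l))
        fun k l => ⟨_, hr' k l⟩
      rwa [← one_add_one_eq_two, ← add_assoc] at this
    · rw [one_add_of_isSuccLimit hβ] at hs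
      have h1 : 1 < β := Ordinal.one_lt_of_isSuccLimit hβ
      choose γ r hγ hr h using fun k => (hs k).exists_eq_iInter_compl h1
      simp only [h, Set.compl_iInter, compl_compl]
      exact hasTransforms_iInter_iUnion_succ (γ := fun k l => γ k l) (.inr hβ)
        (fun k l => WithBot.coe_lt_coe.2 (hγ k l).2)
        -- The class `γ` is enlarged to `1 + γ`, the form required by the induction hypothesis; this
        -- is harmless below a limit.
        (fun k l => ih _ ((hγ k l).2.trans (Order.lt_succ β)) ((hr k l).mono (le_one_add _)))
        fun k l => ⟨_, hr k l⟩
  · rw [one_add_of_isSuccLimit hα] at hA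
    obtain ⟨γ, s, hγ, hs, rfl⟩ := hA.exists_eq_iInter_compl (Ordinal.one_lt_of_isSuccLimit hα)
    -- Complementing costs one level, which a limit leaves room for.
    have hγα (k) : γ k + 1 < α := hα.succ_lt (hγ k).2
    exact hasTransforms_iInter_of_isSuccLimit (γ := fun k => ((γ k + 1 : Ordinal.{0}) :)) hα
      (fun k => WithBot.coe_lt_coe.2 (hγα k))
      fun k => ih _ (hγα k) (((hs k).compl (hγ k).1).mono (le_one_add _))

instance (N : Mod L) : Nonempty N.str.carrier := ⟨N.pt 0⟩

/-- The ball is all of $D(N)$ and every $\pi(y)$ is isomorphic to $N$, so the exceptional set is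
empty or everything; the latter is nonmeagre since $D(N)$ is a nonempty Baire space. -/
theorem vaughtStar_isoClass (M : Mod L) {u : ℝ} (a : Fin 0 → ℕ) :
    vaughtStar M.isoClass a u = M.isoClass := by
  ext N
  have hball : seqBall (M := N.str) (N.pt ∘ a) u = Set.univ :=
    Set.eq_univ_of_forall fun y i => i.elim0
  constructor
  · intro h
    by_contra hN
    refine not_isMeagre_of_isOpen (X := D N.str) isOpen_univ ⟨⟨N.pt, N.tailDense_pt⟩, trivial⟩
      (IsMeagre.mono (fun y _ => ?_) h)
    exact ⟨hball ▸ trivial, fun hy => hN (Isomorphic.trans hy (isomorphic_toMod y).symm)⟩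
  · intro h
    refine IsMeagre.mono (fun y hy => ?_) IsMeagre.empty
    exact hy.2 (Isomorphic.trans h (isomorphic_toMod y))

end MetricLogic

theorem mainTheorem7 (L : MetricLogic.Signature) (F : MetricLogic.Fragment L)
    (α : Ordinal.{0}) (hα : 1 ≤ α) (hα' : α < ω₁) :
    (∀ A : Set (MetricLogic.Mod L),
      MetricLogic.BoldPi (MetricLogic.fragmentTopology F) (1 + α) A →
      ∀ (n : ℕ) (a : Fin n → ℕ) (u : ℚ), 0 < u →
      ∃ (r : ℝ) (P : MetricLogic.AEFamily F (α : WithBot Ordinal.{0}) n r),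
        MetricLogic.vaughtStar A a (u : ℝ) = {N | P.Realizes N.str (N.pt ∘ a)}) ∧
    (∀ M : MetricLogic.Mod L,
      MetricLogic.BoldPi (MetricLogic.fragmentTopology F) (1 + α) M.isoClass →
      ∃ (r : ℝ) (P : MetricLogic.AEFamily F (α : WithBot Ordinal.{0}) 0 r),
        M.isoClass = {N | P.IsModel N.str}) := by
  have transform : ∀ A : Set (MetricLogic.Mod L),
      MetricLogic.BoldPi (MetricLogic.fragmentTopology F) (1 + α) A →
      ∀ (n : ℕ) (a : Fin n → ℕ) (u : ℚ), 0 < u →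
      ∃ (r : ℝ) (P : MetricLogic.AEFamily F (α : WithBot Ordinal.{0}) n r),
        MetricLogic.vaughtStar A a (u : ℝ) = {N | P.Realizes N.str (N.pt ∘ a)} := by
    intro A hA n a u hu
    obtain ⟨r, -, P, hP⟩ := hA.hasTransforms α n u hu
    exact ⟨r, P, Set.ext fun N => hP N.str (N.pt ∘ a)⟩
  refine ⟨transform, fun M hM => ?_⟩
  -- The radius $1$ is arbitrary: a ball around the empty tuple is everything.
  obtain ⟨r, P, hP⟩ := transform _ hM 0 Fin.elim0 1 one_pos
  refine ⟨r, P, ?_⟩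
  rw [← MetricLogic.vaughtStar_isoClass M (u := ((1 : ℚ) : ℝ)) Fin.elim0, hP]
  ext N
  simp only [MetricLogic.AEFamily.IsModel, Set.mem_ofPred_eq]
  rw [Subsingleton.elim (N.pt ∘ Fin.elim0) Fin.elim0]
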